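/- Let $D=(V,A)$ be a finite directed graph (parallel edges and loops allowed) with bounds $f:A\to\mathbb{Z}\cup\{-\infty\}$ and $g:A\to\mathbb{Z}\cup\{+\infty\}$ satisfying $f\le g$, and let $m:V\to\mathbb{Z}$ satisfy $\sum_{v\in V}m(v)=0$. An $m$-flow is a vector $x\in\mathbb{R}^A$ such that, for every node $v$, the sum of $x(e)$ over the edges $e$ entering $v$ minus the sum of $x(e)$ over the edges $e$ leaving $v$ equals $m(v)$; it is $(f,g)$-bounded if $f\le x\le g$. For $F\subseteq A$, an integral $(f,g)$-bounded $m$-flow $z$ is called decreasingly minimal on $F$ if the sequence of the values $z(e)$, $e\in F$ (with multiplicity), arranged in decreasing order, is lexicographically smallest among the sequences obtained in this way from all integral $(f,g)$-bounded $m$-flows. Assume that there exists a (real-valued) $(f,g)$-bounded $m$-flow, and let $F\subseteq A$ be a set of edges such that both $f$ and $g$ are finite-valued on $F$. Then there exist functions $f^*:A\to\mathbb{Z}\cup\{-\infty\}$ and $g^*:A\to\mathbb{Z}\cup\{+\infty\}$ with $f\le f^*\le g^*\le g$ such that an integral $(f,g)$-bounded $m$-flow $z$ is decreasingly minimal on $F$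 if and only if $z$ is an integral $(f^*,g^*)$-bounded $m$-flow. Moreover, $f^*$ and $g^*$ are finite on $F$ and $0\le g^*(e)-f^*(e)\le 1$ for every $e\in F$. -/

import Mathlib

/-- A directed graph with node type `V` and edge type `A` (parallel edges and loops allowed). -/
structure DirectedMultigraph (V A : Type*) where
  /-- the initial node of an edge -/
  tail : A → V
  /-- the terminal node of an edge -/
  head : A → V

namespace DirectedMultigraph

variable {V A : Type*} [Fintype A] [DecidableEq V]

/-- The total `x`-value of the edges with head `v`. -/
def inflow {R : Type*} [AddCommMonoid R] (D : DirectedMultigraph V A) (x : A → R) (v : V) : R :=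
  ∑ e with D.head e = v, x e

/-- The total `x`-value of the edges with tail `v`.
A loop at `v` is counted in both `inflow` and `outflow`, so it cancels in the net inflow. -/
def outflow {R : Type*} [AddCommMonoid R] (D : DirectedMultigraph V A) (x : A → R) (v : V) : R :=
  ∑ e with D.tail e = v, x e

/-- `x` is a modular flow with respect to `m`: the net inflow at each node `v` is `m v`. -/
def IsModFlow (D : DirectedMultigraph V A) (m : V → ℤ) (x : A → ℝ) : Prop :=
  ∀ v, D.inflow x v - D.outflow x v = (m v : ℝ)

end DirectedMultigraph

/-- `a ≤ b` for `a ∈ ℤ ∪ {-∞}` and `b ∈ ℤ ∪ {+∞}`, compared in `ℤ ∪ {-∞, +∞}`. -/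
def BoundLE (a : WithBot ℤ) (b : WithTop ℤ) : Prop :=
  a.map (fun k : ℤ => (k : WithTop ℤ)) ≤ (b : WithBot (WithTop ℤ))

/-- The box `T(f, g) = {x : f ≤ x ≤ g}` in `ℝ^A`. -/
def box {A : Type*} (f : A → WithBot ℤ) (g : A → WithTop ℤ) : Set (A → ℝ) :=
  {x | ∀ e, (f e).map (fun k : ℤ => (k : ℝ)) ≤ (x e : WithBot ℝ) ∧
    (x e : WithTop ℝ) ≤ (g e).map (fun k : ℤ => (k : ℝ))}

/-- The set `Q(f, g; m)` of (real-valued) `(f, g)`-bounded `m`-flows. -/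
def feasibleFlows {V A : Type*} [Fintype A] [DecidableEq V] (D : DirectedMultigraph V A)
    (f : A → WithBot ℤ) (g : A → WithTop ℤ) (m : V → ℤ) : Set (A → ℝ) :=
  {x | x ∈ box f g ∧ D.IsModFlow m x}

/-- The set of integral elements of `Q(f, g; m)`. -/
def integralFeasibleFlows {V A : Type*} [Fintype A] [DecidableEq V] (D : DirectedMultigraph V A)
    (f : A → WithBot ℤ) (g : A → WithTop ℤ) (m : V → ℤ) : Set (A → ℤ) :=
  {z | (fun e => (z e : ℝ)) ∈ feasibleFlows D f g m}

/-- The list of all components of `x`, with multiplicity, in decreasing order. -/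
def decreasingList {ι : Type*} [Fintype ι] (x : ι → ℤ) : List ℤ :=
  (Finset.univ.val.map x).sort (fun a b => b ≤ a)

/-- `x` is a decreasingly minimal element of `Q`: its largest component is as small as possible,
within this its next largest component is as small as possible, and so on; that is, its list of
components in decreasing order is lexicographically smallest. -/
def IsDecMin {ι : Type*} [Fintype ι] (Q : Set (ι → ℤ)) (x : ι → ℤ) : Prop :=
  x ∈ Q ∧ ∀ y ∈ Q, decreasingList x ≤ decreasingList y

/-- `z` is an element of `Q` that is decreasingly minimal on `F`: its restriction to `F` is
decreasingly minimal among the restrictions to `F` of the elements of `Q`. -/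
def IsDecMinOn {A : Type*} (F : Finset A) (Q : Set (A → ℤ)) (z : A → ℤ) : Prop :=
  z ∈ Q ∧ IsDecMin ((fun y : A → ℤ => fun e : F => y e) '' Q) (fun e : F => z e)

/-!
On vectors that are bounded below, comparing the decreasing rearrangements of the entries in `F`
lexicographically is the same as comparing the sums of `N ^ z e` over `e ∈ F`, as soon as `N`
exceeds the cardinality of `F` (`isDecMinOn_iff`). Thus the decreasingly minimal flows on `F` are
the integral flows of minimum cost for a separable convex cost which is strictly convex on the
edges in `F` and zero elsewhere.

For an optimal flow `z` the residual graph has no negative cycle, and shortest walks give an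
integral potential `π` (`exists_potential_of_isMin`). Adding to the cost of each edge the potential
difference times the value changes the total cost of all flows by the same constant, and every
component of `z` minimizes the reduced cost of its edge. Hence a flow is optimal if and only if
each of its components is a minimizer of the reduced cost on its edge. On an edge of `F` the
minimizers form an interval with at most two elements by strict convexity; on another edge the
reduced cost is linear, and the minimizers are `z e` alone or all allowed values. The end points
of these intervals are the required bounds.

The existence of an integral flow follows from the same lemma on potentials, applied to the
problem of minimizing the total violation of the flow conditions by an integral vector in the box
(`integralFeasibleFlows_nonempty`).
-/

namespace DirectedMultigraph

/-! ### Walks and shortest-walk potentials -/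

/-- `D.IsWalk u l w`: the edges of the list `l`, traversed in order from tail to head, lead from
`u` to `w`. -/
def IsWalk {V E : Type*} (D : DirectedMultigraph V E) : V → List E → V → Prop
  | u, [], w => u = w
  | u, e :: l, w => D.tail e = u ∧ D.IsWalk (D.head e) l w

section Walks

variable {V E : Type*} (D : DirectedMultigraph V E)

theorem isWalk_append {l₁ l₂ : List E} {u w : V} :
    D.IsWalk u (l₁ ++ l₂) w ↔ ∃ v, D.IsWalk u l₁ v ∧ D.IsWalk v l₂ w := by
  induction l₁ generalizing u with
  | nil => simp [IsWalk]
  | cons e l ih => simp [IsWalk, ih, and_assoc]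

theorem IsWalk.sum_sub {l : List E} {u w : V} (h : D.IsWalk u l w) (G : V → ℤ) :
    (l.map fun e => G (D.head e) - G (D.tail e)).sum = G w - G u := by
  induction l generalizing u with
  | nil => obtain rfl : u = w := h; simp
  | cons e l ih =>
    obtain ⟨rfl, h⟩ := h
    simp [ih h]

/-- A walk that leaves some node twice contains a nonempty closed walk, the removal of which
leaves a nonempty walk. -/
theorem IsWalk.exists_closed_subwalk {l : List E} {u w : V} (h : D.IsWalk u l w)
    (hl : ¬ (l.map D.tail).Nodup) :
    ∃ l₁ l₂ l₃ v, l = l₁ ++ (l₂ ++ l₃) ∧ l₂ ≠ [] ∧ l₃ ≠ [] ∧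
      D.IsWalk u l₁ v ∧ D.IsWalk v l₂ v ∧ D.IsWalk v l₃ w := by
  induction l generalizing u with
  | nil => simp at hl
  | cons e l ih =>
    obtain ⟨rfl, h⟩ := h
    by_cases he : D.tail e ∈ l.map D.tail
    · obtain ⟨e', he', hee'⟩ := List.mem_map.1 he
      obtain ⟨s, t, rfl⟩ := List.append_of_mem he'
      obtain ⟨v, h₁, h₂, h₃⟩ := (D.isWalk_append).1 h
      obtain rfl : v = D.tail e := by rw [← h₂, hee']
      exact ⟨[], e :: s, e' :: t, D.tail e, by simp, by simp, by simp, rfl, ⟨rfl, h₁⟩, h₂, h₃⟩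
    · have hl' : ¬ (l.map D.tail).Nodup := fun hn => hl (by simpa using ⟨by simpa using he, hn⟩)
      obtain ⟨l₁, l₂, l₃, v, rfl, h2, h3, w1, w2, w3⟩ := ih h hl'
      exact ⟨e :: l₁, l₂, l₃, v, by simp, h2, h3, ⟨rfl, w1⟩, w2, w3⟩

variable (c : E → ℤ)

/-- It suffices to exclude negative closed walks among those that leave every node at most once. -/
theorem closed_walk_cost_nonneg
    (hc : ∀ v l, D.IsWalk v l v → (l.map D.tail).Nodup → 0 ≤ (l.map c).sum)
    (n : ℕ) (l : List E) (hn : l.length = n) (v : V) (h : D.IsWalk v l v) :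
    0 ≤ (l.map c).sum := by
  induction n using Nat.strong_induction_on generalizing l v with
  | _ n ih =>
    by_cases hl : (l.map D.tail).Nodup
    · exact hc v l h hl
    · obtain ⟨l₁, l₂, l₃, w, rfl, h2, h3, w1, w2, w3⟩ := h.exists_closed_subwalk D hl
      have p2 := List.length_pos_of_ne_nil h2
      have p3 := List.length_pos_of_ne_nil h3
      simp only [List.length_append] at hn
      have i1 := ih _ (by omega) l₂ rfl w w2
      have i2 := ih _ (by rw [List.length_append]; omega) (l₁ ++ l₃) rfl v
        ((D.isWalk_append).2 ⟨w, w1, w3⟩)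
      simp only [List.map_append, List.sum_append] at i2 ⊢
      linarith

/-- Removing closed subwalks, which have nonnegative cost, reduces a walk to one that uses every
edge at most once. -/
theorem walk_cost_bounded_below [Fintype E]
    (hc : ∀ v l, D.IsWalk v l v → (l.map D.tail).Nodup → 0 ≤ (l.map c).sum)
    (n : ℕ) (l : List E) (hn : l.length = n) (u w : V) (h : D.IsWalk u l w) :
    -∑ e, |c e| ≤ (l.map c).sum := by
  classical
  induction n using Nat.strong_induction_on generalizing l with
  | _ n ih =>
    by_cases hl : (l.map D.tail).Nodup
    · rw [← List.sum_toFinset _ hl.of_map, neg_le]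
      calc -∑ e ∈ l.toFinset, c e ≤ |∑ e ∈ l.toFinset, c e| := neg_le_abs _
        _ ≤ ∑ e ∈ l.toFinset, |c e| := Finset.abs_sum_le_sum_abs _ _
        _ ≤ ∑ e, |c e| :=
          Finset.sum_le_sum_of_subset_of_nonneg (Finset.subset_univ _) fun _ _ _ => abs_nonneg _
    · obtain ⟨l₁, l₂, l₃, v, rfl, h2, h3, w1, w2, w3⟩ := h.exists_closed_subwalk D hl
      have p2 := List.length_pos_of_ne_nil h2
      simp only [List.length_append] at hn
      have i1 := D.closed_walk_cost_nonneg c hc _ l₂ rfl v w2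
      have i2 := ih _ (by rw [List.length_append]; omega) (l₁ ++ l₃) rfl
        ((D.isWalk_append).2 ⟨v, w1, w3⟩)
      simp only [List.map_append, List.sum_append] at i2 ⊢
      linarith

/-- If no closed walk that leaves every node at most once has negative cost, then the least cost
of a walk ending at a given node, with arbitrary initial node, is a feasible potential. -/
theorem exists_potential [Fintype E]
    (hc : ∀ v l, D.IsWalk v l v → (l.map D.tail).Nodup → 0 ≤ (l.map c).sum) :
    ∃ π : V → ℤ, ∀ e, π (D.head e) ≤ π (D.tail e) + c e := by
  let S : V → Set ℤ := fun v => {k | ∃ u l, D.IsWalk u l v ∧ (l.map c).sum = k}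
  have hne : ∀ v, (S v).Nonempty := fun v => ⟨0, v, [], rfl, rfl⟩
  have hbd : ∀ v, BddBelow (S v) := by
    intro v
    refine ⟨-∑ e, |c e|, ?_⟩
    rintro _ ⟨u, l, h, rfl⟩
    exact D.walk_cost_bounded_below c hc _ l rfl u v h
  refine ⟨fun v => sInf (S v), fun e => ?_⟩
  obtain ⟨u, l, h, hk⟩ := Int.csInf_mem (hne (D.tail e)) (hbd (D.tail e))
  refine csInf_le (hbd _) ⟨u, l ++ [e], (D.isWalk_append).2 ⟨_, h, rfl, rfl⟩, ?_⟩
  simp [hk]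

end Walks

/-! ### Net inflow -/

section NetInflow

variable {V A : Type*} [Fintype A] [DecidableEq V] {R : Type*} [CommRing R]

/-- The inflow minus the outflow at a node. -/
def netInflow (D : DirectedMultigraph V A) (x : A → R) (v : V) : R :=
  D.inflow x v - D.outflow x v

theorem netInflow_eq_sum (D : DirectedMultigraph V A) (x : A → R) (v : V) :
    D.netInflow x v =
      ∑ e, x e * ((if D.head e = v then 1 else 0) - (if D.tail e = v then 1 else 0)) := by
  simp [netInflow, inflow, outflow, Finset.sum_filter, mul_sub, Finset.sum_sub_distrib]

theorem netInflow_intCast (D : DirectedMultigraph V A) (z : A → ℤ) (v : V) :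
    D.netInflow (fun e => (z e : ℝ)) v = ((D.netInflow z v : ℤ) : ℝ) := by
  simp [netInflow, inflow, outflow]

/-- Summation by parts: the potential differences along the edges pair with a vector as the
potential does with its net inflow, up to sign. -/
theorem sum_potential_mul [Fintype V] (D : DirectedMultigraph V A) (π : V → R) (x : A → R) :
    ∑ e, (π (D.tail e) - π (D.head e)) * x e = -∑ v, π v * D.netInflow x v := by
  simp only [netInflow_eq_sum, Finset.mul_sum]
  rw [Finset.sum_comm, ← Finset.sum_neg_distrib]
  refine Finset.sum_congr rfl fun e _ => ?_
  have : ∀ v, π v * (x e * ((if D.head e = v then 1 else 0) - (if D.tail e = v then 1 else 0))) =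
      x e * ((if D.head e = v then π v else 0) - (if D.tail e = v then π v else 0)) := by
    intro v; split_ifs <;> ring
  simp only [this]
  rw [← Finset.mul_sum, Finset.sum_sub_distrib]
  simp
  ring

end NetInflow

/-! ### Potentials of optimal integral flows -/

section Optimality

variable {V A : Type*}

/-- The two orientations of every edge of `D`: `(e, true)` is `e` and `(e, false)` its reversal. -/
def bidirect (D : DirectedMultigraph V A) : DirectedMultigraph V (A × Bool) where
  tail a := if a.2 then D.tail a.1 else D.head a.1
  head a := if a.2 then D.head a.1 else D.tail a.1

/-- The change of value made to an edge by pushing one unit along an orientation of it. -/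
def unitStep (b : Bool) : ℤ := if b then 1 else -1

/-- The subgraph of `bidirect` formed by the orientations along which one unit can be pushed from
`z` without leaving the sets `S e` of allowed values. -/
def residual (D : DirectedMultigraph V A) (S : A → Set ℤ) (z : A → ℤ) :
    DirectedMultigraph V {a : A × Bool // z a.1 + unitStep a.2 ∈ S a.1} where
  tail a := D.bidirect.tail a
  head a := D.bidirect.head a

/-- A vector of allowed integers that minimizes a separable convex cost among those with its net
inflow has a potential for which no unit step on a single edge decreases the reduced cost: a
cycle of the residual graph that leaves each node at most once uses each orientation of an edge at
most once, so that pushing one unit along it gives a competitor. -/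
theorem exists_potential_of_isMin [Fintype A] [DecidableEq V] (D : DirectedMultigraph V A)
    (S : A → Set ℤ) (φ : A → ℤ → ℤ) (hφ : ∀ e t, 2 * φ e t ≤ φ e (t - 1) + φ e (t + 1))
    (z : A → ℤ) (hz : ∀ e, z e ∈ S e)
    (hmin : ∀ y : A → ℤ, (∀ e, y e ∈ S e) → (∀ v, D.netInflow y v = D.netInflow z v) →
      ∑ e, φ e (z e) ≤ ∑ e, φ e (y e)) :
    ∃ π : V → ℤ, ∀ e,
      (z e + 1 ∈ S e → φ e (z e) ≤ φ e (z e + 1) + (π (D.tail e) - π (D.head e))) ∧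
      (z e - 1 ∈ S e → φ e (z e) ≤ φ e (z e - 1) - (π (D.tail e) - π (D.head e))) := by
  classical
  let cost : A × Bool → ℤ := fun a => φ a.1 (z a.1 + unitStep a.2) - φ a.1 (z a.1)
  obtain ⟨π, hπ⟩ := (D.residual S z).exists_potential (fun a => cost a.1) (by
    intro v l hl hnd
    set L : Finset (A × Bool) := (l.map Subtype.val).toFinset with hL
    have hnd' : (l.map Subtype.val).Nodup := hnd.of_map.map Subtype.val_injective
    have hsum : ∀ G : A × Bool → ℤ, (l.map fun a => G a.1).sum =
        ∑ e, ((if (e, true) ∈ L then G (e, true) else 0) +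
          (if (e, false) ∈ L then G (e, false) else 0)) := by
      intro G
      have h1 : (l.map fun a => G a.1).sum = ∑ a ∈ L, G a := by
        rw [hL, List.sum_toFinset _ hnd', List.map_map]; rfl
      have h2 : ∑ a ∈ L, G a = ∑ a, if a ∈ L then G a else 0 := by
        rw [← Finset.sum_filter]; simp
      rw [h1, h2, Fintype.sum_prod_type]
      simp
    have hmem : ∀ a ∈ L, z a.1 + unitStep a.2 ∈ S a.1 := by
      intro a ha
      obtain ⟨b, -, rfl⟩ := List.mem_map.1 (List.mem_toFinset.1 ha)
      exact b.2
    let d : A → ℤ := fun e => (if (e, true) ∈ L then 1 else 0) - (if (e, false) ∈ L then 1 else 0)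
    -- When both orientations of `e` are used they cancel, and their costs add up to a nonnegative
    -- number by convexity.
    have hd : ∀ e, z e + d e ∈ S e ∧ φ e (z e + d e) - φ e (z e) ≤
        (if (e, true) ∈ L then cost (e, true) else 0) +
          (if (e, false) ∈ L then cost (e, false) else 0) := by
      intro e
      have ht := hmem (e, true)
      have hf := hmem (e, false)
      have hc := hφ e (z e)
      by_cases h1 : (e, true) ∈ L <;> by_cases h2 : (e, false) ∈ L
      · simp only [unitStep, d, cost, h1, h2, if_true, sub_self, add_zero]
        refine ⟨hz e, ?_⟩
        simp only [Bool.false_eq_true, if_false, ← sub_eq_add_neg]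
        linarith
      · simpa [d, h1, h2, cost, unitStep] using ht h1
      · simpa [d, h1, h2, cost, unitStep] using hf h2
      · simpa [d, h1, h2] using hz e
    -- The changes of the net inflow telescope along the closed walk.
    have hnet : ∀ w, D.netInflow (fun e => z e + d e) w = D.netInflow z w := by
      intro w
      have h0 := hl.sum_sub _ (fun u => if u = w then 1 else 0)
      have h1 := hsum (fun a => (if D.bidirect.head a = w then 1 else 0) -
        (if D.bidirect.tail a = w then 1 else 0))
      have h2 : ∑ e, d e * ((if D.head e = w then 1 else 0) - (if D.tail e = w then 1 else 0)) =
          0 := by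
        rw [sub_self] at h0
        refine Eq.trans ?_ (h1.symm.trans h0)
        refine Finset.sum_congr rfl fun e _ => ?_
        simp only [d, bidirect, if_true, Bool.false_eq_true, if_false]
        by_cases h1 : (e, true) ∈ L <;> by_cases h2 : (e, false) ∈ L <;> simp [h1, h2]
      simp only [netInflow_eq_sum, add_mul, Finset.sum_add_distrib, h2, add_zero]
    have h := hmin _ (fun e => (hd e).1) hnet
    have h' := Finset.sum_le_sum fun e (_ : e ∈ Finset.univ) => (hd e).2
    rw [Finset.sum_sub_distrib] at h'
    rw [hsum cost]
    linarith)
  refine ⟨π, fun e => ⟨fun h => ?_, fun h => ?_⟩⟩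
  · have := hπ ⟨(e, true), by simpa [unitStep] using h⟩
    simp only [residual, bidirect, cost, unitStep, if_true] at this
    linarith
  · have := hπ ⟨(e, false), by simpa [unitStep, sub_eq_add_neg] using h⟩
    simp only [residual, bidirect, cost, unitStep, Bool.false_eq_true, if_false,
      ← sub_eq_add_neg] at this
    linarith

end Optimality

end DirectedMultigraph

/-! ### Integral vectors in boxes -/

/-- The integers in the interval `[a, b]`. -/
def boundSet (a : WithBot ℤ) (b : WithTop ℤ) : Set ℤ :=
  {t | a ≤ t ∧ (t : WithTop ℤ) ≤ b}

theorem map_intCast_le_coe (a : WithBot ℤ) (t : ℝ) :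
    a.map (fun k : ℤ => (k : ℝ)) ≤ (t : WithBot ℝ) ↔ a ≤ (⌊t⌋ : WithBot ℤ) := by
  cases a <;> simp [Int.le_floor]

theorem coe_le_map_intCast (b : WithTop ℤ) (t : ℝ) :
    (t : WithTop ℝ) ≤ b.map (fun k : ℤ => (k : ℝ)) ↔ (⌈t⌉ : WithTop ℤ) ≤ b := by
  cases b <;> simp [Int.ceil_le]

theorem mem_integralFeasibleFlows {V A : Type*} [Fintype A] [DecidableEq V]
    (D : DirectedMultigraph V A) (f : A → WithBot ℤ) (g : A → WithTop ℤ) (m : V → ℤ) (z : A → ℤ) :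
    z ∈ integralFeasibleFlows D f g m ↔
      (∀ e, z e ∈ boundSet (f e) (g e)) ∧ ∀ v, D.netInflow z v = m v := by
  simp only [integralFeasibleFlows, feasibleFlows, box, Set.mem_ofPred_eq, map_intCast_le_coe,
    coe_le_map_intCast, Int.floor_intCast, Int.ceil_intCast]
  refine and_congr Iff.rfl (forall_congr' fun v => ?_)
  have := D.netInflow_intCast z v
  rw [DirectedMultigraph.netInflow] at this
  rw [this]
  exact Int.cast_inj (α := ℝ)

/-! ### Integral feasibility -/

namespace DirectedMultigraph

/-- The graph `D` with a new node `none` and a new edge from every node of `D` to it. -/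
def withSink {V A : Type*} (D : DirectedMultigraph V A) :
    DirectedMultigraph (Option V) (A ⊕ V) where
  tail := Sum.elim (fun e => some (D.tail e)) some
  head := Sum.elim (fun e => some (D.head e)) fun _ => none

theorem netInflow_withSink {V A : Type*} [Fintype V] [Fintype A] [DecidableEq V]
    (D : DirectedMultigraph V A) (x : A ⊕ V → ℤ) (v : V) :
    D.withSink.netInflow x (some v) = D.netInflow (fun e => x (.inl e)) v - x (.inr v) := by
  simp [netInflow_eq_sum, withSink, sub_eq_add_neg]

end DirectedMultigraph

/-- If a real flow exists, then so does an integral one. Integral vectors in the box, together with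
an edge from each node to a new one that carries off the deviation from `m`, are flows of
`withSink`. For one with least total deviation, the potential of `exists_potential_of_isMin` gives
a lower bound for the deviation of every real vector in the box, by weak duality; a real feasible
flow shows that this bound is at most zero. -/
theorem integralFeasibleFlows_nonempty {V A : Type*} [Fintype V] [DecidableEq V] [Fintype A]
    (D : DirectedMultigraph V A) (f : A → WithBot ℤ) (g : A → WithTop ℤ) (m : V → ℤ)
    (hfeas : (feasibleFlows D f g m).Nonempty) : (integralFeasibleFlows D f g m).Nonempty := by
  obtain ⟨x, hx, hxm⟩ := hfeas
  let S : A ⊕ V → Set ℤ := Sum.elim (fun e => boundSet (f e) (g e)) fun _ => Set.univ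
  let T : Set (A ⊕ V → ℤ) :=
    {y | (∀ a, y a ∈ S a) ∧ ∀ v, D.withSink.netInflow y (some v) = m v}
  have hT : T.Nonempty := by
    refine ⟨Sum.elim (fun e => ⌊x e⌋) fun v => D.netInflow (fun e => ⌊x e⌋) v - m v, ?_, ?_⟩
    · rintro (e | v)
      · refine ⟨(map_intCast_le_coe _ _).1 (hx e).1, le_trans ?_ ((coe_le_map_intCast _ _).1 (hx e).2)⟩
        exact WithTop.coe_le_coe.2 (Int.floor_le_ceil _)
      · exact Set.mem_univ _
    · intro v
      rw [D.netInflow_withSink]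
      simp
  obtain ⟨y, ⟨hyS, hym⟩, hy⟩ := exists_minimalFor_of_wellFoundedLT T
    (fun y => ∑ v, (y (.inr v)).natAbs) hT
  let φ : A ⊕ V → ℤ → ℤ := Sum.elim (fun _ _ => 0) fun _ t => |t|
  have hφ : ∀ a t, 2 * φ a t ≤ φ a (t - 1) + φ a (t + 1) := by
    rintro (e | v) t
    · simp [φ]
    · simp only [φ, Sum.elim_inr]
      grind
  have hsum : ∀ y' : A ⊕ V → ℤ, ∑ a, φ a (y' a) = ((∑ v, (y' (.inr v)).natAbs : ℕ) : ℤ) := by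
    intro y'; simp [φ]
  obtain ⟨π, hπ⟩ := D.withSink.exists_potential_of_isMin S φ hφ y hyS (by
    intro y' hy'S hy'
    rw [hsum, hsum, Nat.cast_le]
    exact (le_total _ _).elim id
      (hy (show y' ∈ T from ⟨hy'S, fun v => (hy' (some v)).trans (hym v)⟩)))
  -- Normalizing the potential to vanish at the new node removes that node from the duality.
  let ρ : V → ℤ := fun v => π (some v) - π none
  have hv : ∀ v, |y (.inr v)| ≤ -(ρ v * y (.inr v)) := by
    intro v
    obtain ⟨h1, h2⟩ := hπ (.inr v)
    have h1 := h1 (Set.mem_univ _)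
    have h2 := h2 (Set.mem_univ _)
    simp only [φ, DirectedMultigraph.withSink, Sum.elim_inr] at h1 h2
    change |y (.inr v)| ≤ |y (.inr v) + 1| + ρ v at h1
    change |y (.inr v)| ≤ |y (.inr v) - 1| - ρ v at h2
    generalize y (.inr v) = t at *
    generalize ρ v = r at *
    rcases lt_trichotomy t 0 with ht | rfl | ht
    · rw [abs_of_neg ht] at *
      rw [abs_of_nonpos (by omega)] at h1
      nlinarith
    · simp
    · rw [abs_of_pos ht] at *
      rw [abs_of_nonneg (by omega)] at h2
      nlinarith
  have he : ∀ e, ((ρ (D.tail e) : ℝ) - ρ (D.head e)) * y (.inl e) ≤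
      ((ρ (D.tail e) : ℝ) - ρ (D.head e)) * x e := by
    intro e
    obtain ⟨h1, h2⟩ := hπ (.inl e)
    obtain ⟨hl, hu⟩ := hyS (.inl e)
    obtain ⟨xl, xu⟩ := hx e
    rw [map_intCast_le_coe] at xl
    rw [coe_le_map_intCast] at xu
    simp only [φ, S, DirectedMultigraph.withSink, Sum.elim_inl, boundSet, Set.mem_ofPred_eq,
      zero_add, zero_sub, Left.nonneg_neg_iff] at h1 h2 hl hu
    have hρ : π (some (D.tail e)) - π (some (D.head e)) = ρ (D.tail e) - ρ (D.head e) := by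
      simp [ρ]
    rw [hρ] at h1 h2
    have hcast : (ρ (D.tail e) : ℝ) - ρ (D.head e) = ((ρ (D.tail e) - ρ (D.head e) : ℤ) : ℝ) := by
      push_cast; rfl
    rw [hcast]
    generalize ρ (D.tail e) - ρ (D.head e) = p at *
    generalize y (.inl e) = t at *
    rcases lt_trichotomy p 0 with hp | rfl | hp
    · have ht : ⌈x e⌉ ≤ t := by
        by_contra! hlt
        exact absurd (h1 ⟨hl.trans (WithBot.coe_le_coe.2 (by omega)),
          le_trans (WithTop.coe_le_coe.2 (by omega)) xu⟩) (by omega)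
      have hp' : (p : ℝ) ≤ 0 := by exact_mod_cast hp.le
      exact mul_le_mul_of_nonpos_left (Int.ceil_le.1 ht) hp'
    · simp
    · have ht : t ≤ ⌊x e⌋ := by
        by_contra! hlt
        exact absurd (h2 ⟨xl.trans (WithBot.coe_le_coe.2 (by omega)),
          le_trans (WithTop.coe_le_coe.2 (by omega)) hu⟩) (by omega)
      have hp' : (0 : ℝ) ≤ p := by exact_mod_cast hp.le
      exact mul_le_mul_of_nonneg_left (Int.le_floor.1 ht) hp'
  have hnet : ∀ v, D.netInflow (fun e => y (.inl e)) v = m v + y (.inr v) := by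
    intro v
    have := hym v
    rw [D.netInflow_withSink] at this
    linarith
  have hzero : ∑ v, |y (.inr v)| ≤ 0 := by
    have h1 := Finset.sum_le_sum fun e (_ : e ∈ Finset.univ) => he e
    rw [D.sum_potential_mul (fun v => (ρ v : ℝ)) (fun e => (y (.inl e) : ℝ)),
      D.sum_potential_mul (fun v => (ρ v : ℝ)) x] at h1
    simp only [D.netInflow_intCast fun e => y (.inl e), hnet] at h1
    have h2 : ∀ v, D.netInflow x v = (m v : ℝ) := hxm
    simp only [h2, Int.cast_add, mul_add, Finset.sum_add_distrib] at h1
    have h3 : (0 : ℝ) ≤ ∑ v, (ρ v : ℝ) * (y (.inr v) : ℝ) := by linarith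
    have h4 : 0 ≤ ∑ v, ρ v * y (.inr v) := by exact_mod_cast h3
    have h5 := Finset.sum_le_sum fun v (_ : v ∈ Finset.univ) => hv v
    rw [Finset.sum_neg_distrib] at h5
    linarith
  have hy0 : ∀ v, y (.inr v) = 0 := by
    intro v
    have := (Finset.single_le_sum (fun v _ => abs_nonneg (y (.inr v))) (Finset.mem_univ v)).trans
      hzero
    exact abs_nonpos_iff.1 this
  exact ⟨fun e => y (.inl e), (mem_integralFeasibleFlows D f g m _).2
    ⟨fun e => hyS (.inl e), fun v => by rw [hnet, hy0, add_zero]⟩⟩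

/-! ### Decreasing minimality as minimality of a separable convex cost -/

/-- The exponential cost `N ^ (t - c)`, cut off to `1` at integers `t` below `c`. -/
def expCost (N : ℕ) (c t : ℤ) : ℕ := N ^ (t - c).toNat

theorem expCost_convex {N : ℕ} (hN : 2 ≤ N) (c t : ℤ) :
    2 * (expCost N c t : ℤ) ≤ expCost N c (t - 1) + expCost N c (t + 1) ∧
      (c ≤ t → 2 * (expCost N c t : ℤ) < expCost N c (t - 1) + expCost N c (t + 1)) := by
  have hN' : (2 : ℤ) ≤ N := by exact_mod_cast hN
  rcases lt_trichotomy t c with h | rfl | h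
  · have h1 : (t - 1 - c).toNat = 0 := by omega
    have h2 : (t - c).toNat = 0 := by omega
    have h3 : (t + 1 - c).toNat = 0 := by omega
    simp only [expCost, h1, h2, h3]
    exact ⟨by norm_num, fun _ => by omega⟩
  · have h1 : (t - 1 - t).toNat = 0 := by omega
    have h3 : (t + 1 - t).toNat = 1 := by omega
    simp only [expCost, h1, h3, sub_self]
    refine ⟨?_, fun _ => ?_⟩ <;> (simp; omega)
  · obtain ⟨k, rfl⟩ : ∃ k : ℕ, t = c + 1 + k := ⟨(t - c - 1).toNat, by omega⟩
    have h1 : (c + 1 + k - 1 - c).toNat = k := by omega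
    have h2 : (c + 1 + k - c).toNat = k + 1 := by omega
    have h3 : (c + 1 + k + 1 - c).toNat = k + 2 := by omega
    simp only [expCost, h1, h2, h3]
    have hp : (0 : ℤ) < (N : ℤ) ^ k := by positivity
    have : 2 * ((N ^ (k + 1) : ℕ) : ℤ) < (N ^ k : ℕ) + (N ^ (k + 2) : ℕ) := by
      push_cast
      rw [pow_succ, pow_add]
      nlinarith [mul_pos hp (show (0 : ℤ) < (N - 1) ^ 2 by nlinarith)]
    exact ⟨this.le, fun _ => this⟩

/-- The cost of an entry exceeds the total cost of fewer than `N` smaller entries, so the first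
difference of two decreasing lists decides which of them is the cheaper one. -/
theorem sum_expCost_lt_of_lt {N : ℕ} {c : ℤ} (l₁ l₂ : List ℤ) (hlen : l₁.length = l₂.length)
    (hN : l₁.length < N) (h₁ : l₁.Pairwise fun a b => b ≤ a) (hc : ∀ t ∈ l₁, c ≤ t)
    (hlt : l₁ < l₂) : (l₁.map (expCost N c)).sum < (l₂.map (expCost N c)).sum := by
  induction l₁ generalizing l₂ with
  | nil =>
    obtain rfl := List.eq_nil_of_length_eq_zero hlen.symm
    exact absurd hlt (lt_irrefl _)
  | cons a l ih =>
    obtain _ | ⟨b, l'⟩ := l₂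
    · simp at hlen
    simp only [List.length_cons, Nat.add_right_cancel_iff] at hlen hN
    rw [List.pairwise_cons] at h₁
    simp only [List.map_cons, List.sum_cons]
    have hca := hc a (by simp)
    rcases List.cons_lt_cons_iff.1 hlt with hab | ⟨rfl, hll⟩
    · have hl : (l.map (expCost N c)).sum ≤ l.length * expCost N c a := by
        have := List.sum_le_card_nsmul (l.map (expCost N c)) (expCost N c a) (by
          intro k hk
          obtain ⟨t, ht, rfl⟩ := List.mem_map.1 hk
          have := h₁.1 t ht
          exact Nat.pow_le_pow_right (by omega) (by omega))
        simpa using this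
      have hp : 0 < expCost N c a := Nat.pow_pos (by omega)
      have hb : N * expCost N c a ≤ expCost N c b := by
        rw [expCost, mul_comm, ← pow_succ]
        exact Nat.pow_le_pow_right (by omega) (by omega)
      have : (l.length + 1) * expCost N c a < N * expCost N c a := Nat.mul_lt_mul_of_pos_right hN hp
      rw [add_one_mul] at this
      omega
    · have := ih l' hlen (by omega) h₁.2 (fun t ht => hc t (by simp [ht])) hll
      omega

theorem decreasingList_le_iff {ι : Type*} [Fintype ι] {N : ℕ} {c : ℤ} (hN : Fintype.card ι < N)
    (x y : ι → ℤ) (hx : ∀ i, c ≤ x i) (hy : ∀ i, c ≤ y i) :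
    decreasingList x ≤ decreasingList y ↔
      ∑ i, expCost N c (x i) ≤ ∑ i, expCost N c (y i) := by
  have hsum : ∀ w : ι → ℤ, ((decreasingList w).map (expCost N c)).sum = ∑ i, expCost N c (w i) := by
    intro w
    rw [← Multiset.sum_coe, ← Multiset.map_coe, decreasingList, Multiset.sort_eq, Multiset.map_map]
    rfl
  have hlen : ∀ w : ι → ℤ, (decreasingList w).length = Fintype.card ι := by
    intro w; simp [decreasingList]
  have key : ∀ v w : ι → ℤ, (∀ i, c ≤ v i) → decreasingList v < decreasingList w →
      ∑ i, expCost N c (v i) < ∑ i, expCost N c (w i) := by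
    intro v w hv h
    rw [← hsum, ← hsum]
    refine sum_expCost_lt_of_lt _ _ (by rw [hlen, hlen]) (by rwa [hlen])
      (Multiset.pairwise_sort _ _) (fun t ht => ?_) h
    obtain ⟨i, -, rfl⟩ := Multiset.mem_map.1 ((Multiset.mem_sort _).1 ht)
    exact hv i
  constructor
  · intro h
    rcases h.lt_or_eq with h | h
    · exact (key x y hx h).le
    · rw [← hsum, ← hsum, h]
  · intro h
    by_contra hlt
    exact absurd (key y x hy (not_le.1 hlt)) (not_lt.2 h)

theorem isDecMinOn_iff {A : Type*} (F : Finset A) (Q : Set (A → ℤ)) {N : ℕ} {c : ℤ}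
    (hN : F.card < N) (hQ : ∀ z ∈ Q, ∀ e ∈ F, c ≤ z e) (z : A → ℤ) :
    IsDecMinOn F Q z ↔
      z ∈ Q ∧ ∀ y ∈ Q, ∑ e ∈ F, expCost N c (z e) ≤ ∑ e ∈ F, expCost N c (y e) := by
  refine and_congr_right fun hz => ?_
  rw [IsDecMin, Set.forall_mem_image]
  refine (and_iff_right (Set.mem_image_of_mem _ hz)).trans (forall₂_congr fun y hy => ?_)
  rw [decreasingList_le_iff (N := N) (c := c) (by simpa using hN) _ _
    (fun i : F => hQ z hz i i.2) (fun i : F => hQ y hy i i.2)]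
  rw [Finset.sum_coe_sort F fun e => expCost N c (z e),
    Finset.sum_coe_sort F fun e => expCost N c (y e)]

/-! ### Minimizers of convex functions on intervals of integers -/

/-- A convex function on the integers lies above its secant line through `t` and `t + 1`, to the
right of `t`. -/
theorem mul_slope_le {h : ℤ → ℤ} (hh : ∀ t, 2 * h t ≤ h (t - 1) + h (t + 1)) (t : ℤ) (n : ℕ) :
    n * (h (t + 1) - h t) ≤ h (t + n) - h t := by
  have hs : ∀ n : ℕ, h (t + 1) - h t ≤ h (t + n + 1) - h (t + n) := by
    intro n
    induction n with
    | zero => simp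
    | succ k ih =>
      have := hh (t + k + 1)
      rw [add_sub_cancel_right] at this
      push_cast
      rw [← add_assoc]
      linarith
  induction n with
  | zero => simp
  | succ k ih =>
    have := hs k
    push_cast
    rw [← add_assoc]
    linarith

theorem le_of_le_add_one {h : ℤ → ℤ} (hh : ∀ t, 2 * h t ≤ h (t - 1) + h (t + 1)) {z t : ℤ}
    (hz : h z ≤ h (z + 1)) (hzt : z ≤ t) : h z ≤ h t := by
  obtain ⟨n, rfl⟩ := Int.le.dest hzt
  have := mul_slope_le hh z n
  have : (0 : ℤ) ≤ n * (h (z + 1) - h z) := mul_nonneg (by positivity) (by linarith)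
  linarith

/-- A local minimizer of a convex function on an interval of integers is a global one. -/
theorem isMin_boundSet {h : ℤ → ℤ} (hh : ∀ t, 2 * h t ≤ h (t - 1) + h (t + 1)) {a : WithBot ℤ}
    {b : WithTop ℤ} {z : ℤ} (hz : z ∈ boundSet a b) (h1 : z + 1 ∈ boundSet a b → h z ≤ h (z + 1))
    (h2 : z - 1 ∈ boundSet a b → h z ≤ h (z - 1)) {t : ℤ} (ht : t ∈ boundSet a b) : h z ≤ h t := by
  rcases lt_trichotomy z t with hlt | rfl | hlt
  · exact le_of_le_add_one hh (h1 ⟨hz.1.trans (WithBot.coe_le_coe.2 (by omega)),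
      le_trans (WithTop.coe_le_coe.2 (by omega)) ht.2⟩) hlt.le
  · rfl
  · have h2 := h2 ⟨ht.1.trans (WithBot.coe_le_coe.2 (by omega)),
      le_trans (WithTop.coe_le_coe.2 (by omega)) hz.2⟩
    have := le_of_le_add_one (h := fun s => h (-s)) (z := -z) (t := -t)
      (fun s => by
        have := hh (-s)
        simp only [neg_sub, neg_add]
        rw [show 1 - s = -s + 1 by ring, ← sub_eq_add_neg]
        linarith)
      (by simpa [sub_eq_add_neg, add_comm] using h2) (by omega)
    simpa using this

/-- If a convex function does not decrease from `s` to `s + 1` and is strictly convex at `s + 1`,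
then all its values to the right of `s + 1` exceed the one at `s`. -/
theorem minimizer_le_add_one {h : ℤ → ℤ} (hh : ∀ t, 2 * h t ≤ h (t - 1) + h (t + 1)) {s t : ℤ}
    (hs : h s ≤ h (s + 1)) (hst : h t ≤ h s) (hstrict : 2 * h (s + 1) < h s + h (s + 2)) :
    t ≤ s + 1 := by
  by_contra! hlt
  obtain ⟨n, rfl⟩ := Int.le.dest (show s + 2 ≤ t by omega)
  have h1 := mul_slope_le hh (s + 1) (n + 1)
  rw [show s + 1 + ((n + 1 : ℕ) : ℤ) = s + 2 + n by push_cast; ring,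
    show s + 1 + 1 = s + 2 by ring] at h1
  have h2 : (0 : ℤ) < ((n + 1 : ℕ) : ℤ) * (h (s + 2) - h (s + 1)) :=
    mul_pos (by positivity) (by linarith)
  linarith

/-- The minimizers of a strictly convex function on an interval of integers, if any, form an interval
with one or two elements. -/
theorem exists_minimizer_interval {h : ℤ → ℤ} (hh : ∀ t, 2 * h t ≤ h (t - 1) + h (t + 1))
    {a : WithBot ℤ} {b : WithTop ℤ} {z : ℤ} (hz : z ∈ boundSet a b)
    (hmin : ∀ t ∈ boundSet a b, h z ≤ h t)
    (hstrict : ∀ t ∈ boundSet a b, 2 * h t < h (t - 1) + h (t + 1)) :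
    ∃ p q : ℤ, a ≤ p ∧ p ≤ q ∧ q - p ≤ 1 ∧ (q : WithTop ℤ) ≤ b ∧
      ∀ t, p ≤ t ∧ t ≤ q ↔ t ∈ boundSet a b ∧ h t = h z := by
  have hconn : ∀ {r s t : ℤ}, r ∈ boundSet a b → t ∈ boundSet a b → r ≤ s → s ≤ t →
      s ∈ boundSet a b := fun hr ht h1 h2 =>
    ⟨hr.1.trans (WithBot.coe_le_coe.2 h1), le_trans (WithTop.coe_le_coe.2 h2) ht.2⟩
  have hclose : ∀ {s t : ℤ}, s ∈ boundSet a b → t ∈ boundSet a b → h s = h z → h t = h z →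
      t ≤ s + 1 := by
    intro s t hs ht hsz htz
    by_contra! hlt
    have hs1 := hconn hs ht (show s ≤ s + 1 by omega) (by omega)
    have h1 := hstrict _ hs1
    rw [add_sub_cancel_right, show s + 1 + 1 = s + 2 by ring] at h1
    have := minimizer_le_add_one hh (hsz.trans_le (hmin _ hs1)) (htz.trans hsz.symm).le h1
    omega
  by_cases c1 : z + 1 ∈ boundSet a b ∧ h (z + 1) = h z
  · refine ⟨z, z + 1, hz.1, by omega, by omega, c1.1.2, fun t => ⟨fun ht => ?_, fun ht => ?_⟩⟩
    · obtain rfl | rfl : t = z ∨ t = z + 1 := by omega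
      exacts [⟨hz, rfl⟩, c1]
    · have i1 := hclose hz ht.1 rfl ht.2
      have i2 := hclose ht.1 c1.1 ht.2 c1.2
      omega
  by_cases c2 : z - 1 ∈ boundSet a b ∧ h (z - 1) = h z
  · refine ⟨z - 1, z, c2.1.1, by omega, by omega, hz.2, fun t => ⟨fun ht => ?_, fun ht => ?_⟩⟩
    · obtain rfl | rfl : t = z ∨ t = z - 1 := by omega
      exacts [⟨hz, rfl⟩, c2]
    · have i1 := hclose c2.1 ht.1 c2.2 ht.2
      have i2 := hclose ht.1 hz ht.2 rfl
      omega
  · refine ⟨z, z, hz.1, le_rfl, by omega, hz.2, fun t => ⟨fun ht => ?_, fun ht => ?_⟩⟩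
    · obtain rfl : t = z := by omega
      exact ⟨hz, rfl⟩
    · have i1 := hclose hz ht.1 rfl ht.2
      have i2 := hclose ht.1 hz ht.2 rfl
      have i3 : t ≠ z + 1 := by rintro rfl; exact c1 ht
      have i4 : t ≠ z - 1 := by rintro rfl; exact c2 ht
      omega

/-! ### The dual description of decreasingly minimal flows -/

theorem mainTheorem1 {V A : Type*} [Fintype V] [DecidableEq V] [Fintype A]
    (D : DirectedMultigraph V A) (f : A → WithBot ℤ) (g : A → WithTop ℤ)
    (hfg : ∀ e, BoundLE (f e) (g e))
    (m : V → ℤ) (hm : ∑ v, m v = 0)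
    (hfeas : (feasibleFlows D f g m).Nonempty)
    (F : Finset A) (hF : ∀ e ∈ F, f e ≠ ⊥ ∧ g e ≠ ⊤) :
    ∃ (fs : A → WithBot ℤ) (gs : A → WithTop ℤ),
      (∀ e, f e ≤ fs e) ∧ (∀ e, BoundLE (fs e) (gs e)) ∧ (∀ e, gs e ≤ g e) ∧
      (∀ z : A → ℤ,
        IsDecMinOn F (integralFeasibleFlows D f g m) z ↔ z ∈ integralFeasibleFlows D fs gs m) ∧
      (∀ e ∈ F, ∃ a b : ℤ, fs e = (a : WithBot ℤ) ∧ gs e = (b : WithTop ℤ) ∧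
        0 ≤ b - a ∧ b - a ≤ 1) := by
  classical
  obtain ⟨c, hc⟩ := (F.image fun e => (f e).unbotD 0).bddBelow
  have hcF : ∀ e ∈ F, ∀ t ∈ boundSet (f e) (g e), c ≤ t := by
    intro e he t ht
    have h1 := hc (Finset.mem_coe.2 (Finset.mem_image_of_mem _ he))
    obtain ⟨k, hk⟩ := WithBot.ne_bot_iff_exists.1 (hF e he).1
    have h2 := ht.1
    rw [← hk] at h1 h2
    exact le_trans h1 (WithBot.coe_le_coe.1 h2)
  let N := F.card + 2
  have hN : 2 ≤ N := by omega
  let Φ : (A → ℤ) → ℕ := fun z => ∑ e ∈ F, expCost N c (z e)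
  have hdec := isDecMinOn_iff F (integralFeasibleFlows D f g m) (N := N) (c := c) (by omega)
    (fun z hz e he => hcF e he _ (((mem_integralFeasibleFlows D f g m z).1 hz).1 e))
  obtain ⟨z, hz, hzmin⟩ := exists_minimalFor_of_wellFoundedLT
    (integralFeasibleFlows D f g m) Φ (integralFeasibleFlows_nonempty D f g m hfeas)
  have hzmin : ∀ y ∈ integralFeasibleFlows D f g m, Φ z ≤ Φ y := fun y hy =>
    (le_total (Φ z) (Φ y)).elim id (hzmin hy)
  obtain ⟨hzB, hzm⟩ := (mem_integralFeasibleFlows D f g m z).1 hz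
  let φ : A → ℤ → ℤ := fun e t => if e ∈ F then (expCost N c t : ℤ) else 0
  have hφ : ∀ e t, 2 * φ e t ≤ φ e (t - 1) + φ e (t + 1) := by
    intro e t
    by_cases he : e ∈ F
    · simpa only [φ, he, if_true] using (expCost_convex hN c t).1
    · simp [φ, he]
  have hsum : ∀ y : A → ℤ, ∑ e, φ e (y e) = Φ y := by
    intro y
    simp [φ, Φ]
  obtain ⟨π, hπ⟩ := D.exists_potential_of_isMin (fun e => boundSet (f e) (g e)) φ hφ z hzB (by
    intro y hyB hy
    rw [hsum, hsum]
    exact_mod_cast hzmin y ((mem_integralFeasibleFlows D f g m y).2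
      ⟨hyB, fun v => (hy v).trans (hzm v)⟩))
  let p : A → ℤ := fun e => π (D.tail e) - π (D.head e)
  let ψ : A → ℤ → ℤ := fun e t => φ e t + p e * t
  have hψ : ∀ e t, 2 * ψ e t ≤ ψ e (t - 1) + ψ e (t + 1) := fun e t => by
    have := hφ e t
    simp only [ψ]
    linarith
  have hψmin : ∀ e, ∀ t ∈ boundSet (f e) (g e), ψ e (z e) ≤ ψ e t := by
    intro e t ht
    refine isMin_boundSet (hψ e) (hzB e) (fun h => ?_) (fun h => ?_) ht
    · have := (hπ e).1 h
      simp only [ψ, p]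
      linarith
    · have := (hπ e).2 h
      simp only [ψ, p]
      linarith
  have hedge : ∀ e, ∃ (a : WithBot ℤ) (b : WithTop ℤ), f e ≤ a ∧ BoundLE a b ∧ b ≤ g e ∧
      (∀ t, t ∈ boundSet a b ↔ t ∈ boundSet (f e) (g e) ∧ ψ e t = ψ e (z e)) ∧
      (e ∈ F → ∃ k l : ℤ, a = (k : WithBot ℤ) ∧ b = (l : WithTop ℤ) ∧ 0 ≤ l - k ∧ l - k ≤ 1) := by
    intro e
    -- The minimizers of the reduced cost on `e` are the integers in an interval `[a, b]`.
    by_cases he : e ∈ F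
    · obtain ⟨k, l, h1, h2, h3, h4, h5⟩ := exists_minimizer_interval (hψ e) (hzB e) (hψmin e) (by
        intro t ht
        have := (expCost_convex hN c t).2 (hcF e he t ht)
        simp only [ψ, φ, he, if_true]
        linarith)
      refine ⟨k, l, h1, ?_, h4, fun t => ?_, fun _ => ⟨k, l, rfl, rfl, by omega, h3⟩⟩
      · simpa [BoundLE] using h2
      · rw [← h5 t]
        simp [boundSet]
    · by_cases hp : p e = 0
      · exact ⟨f e, g e, le_rfl, hfg e, le_rfl, fun t => by simp [ψ, φ, he, hp], fun h => absurd h he⟩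
      -- A linear function with nonzero slope is injective, so `z e` is the only minimizer.
      · refine ⟨z e, z e, (hzB e).1, by simp [BoundLE], (hzB e).2, fun t => ?_, fun h => absurd h he⟩
        have : t ∈ boundSet (z e) (z e) ↔ t = z e := by
          simp [boundSet, le_antisymm_iff, and_comm]
        rw [this]
        constructor
        · rintro rfl
          exact ⟨hzB e, rfl⟩
        · rintro ⟨-, h⟩
          simpa [ψ, φ, he, hp] using h
  choose fs gs h1 h2 h3 h4 h5 using hedge
  refine ⟨fs, gs, h1, h2, h3, fun y => ?_, h5⟩
  rw [hdec, mem_integralFeasibleFlows D fs gs m]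
  simp only [h4]
  -- On flows, the total reduced cost differs from the cost by a constant.
  have hred : ∀ y : A → ℤ, (∀ v, D.netInflow y v = m v) →
      ∑ e, ψ e (y e) = Φ y - ∑ v, π v * m v := by
    intro y hy
    simp only [ψ, p, Finset.sum_add_distrib, hsum, D.sum_potential_mul, hy]
    ring
  constructor
  · rintro ⟨hy, hymin⟩
    obtain ⟨hyB, hym⟩ := (mem_integralFeasibleFlows D f g m y).1 hy
    refine ⟨fun e => ⟨hyB e, ?_⟩, hym⟩
    have hle : ∑ e, ψ e (y e) ≤ ∑ e, ψ e (z e) := by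
      have : (Φ y : ℤ) ≤ Φ z := by exact_mod_cast hymin z hz
      rw [hred y hym, hred z hzm]
      linarith
    have hall := fun e (_ : e ∈ Finset.univ) => hψmin e (y e) (hyB e)
    exact ((Finset.sum_eq_sum_iff_of_le hall).1
      (le_antisymm (Finset.sum_le_sum hall) hle) e (Finset.mem_univ e)).symm
  · rintro ⟨hyB, hym⟩
    refine ⟨(mem_integralFeasibleFlows D f g m y).2 ⟨fun e => (hyB e).1, hym⟩, fun w hw => ?_⟩
    refine le_trans ?_ (hzmin w hw)
    have : ∑ e, ψ e (y e) = ∑ e, ψ e (z e) := Finset.sum_congr rfl fun e _ => (hyB e).2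
    rw [hred y hym, hred z hzm] at this
    change Φ y ≤ Φ z
    omega
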